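/- Let $L>0$, let $M\ge 0$ be an integer, $a_0,a_1,\dots,a_M\in\mathbb C$, and $s\in(0,\pi)$. For a function $u:\mathbb R\to\mathbb C$ the half Laplacian at $x\in\mathbb R$ is $$(-\Delta)^{1/2}u(x)=c_1\,\mathrm{p.v.}\!\int_{-\infty}^{\infty}\frac{u(x)-u(x+y)}{|y|^{2}}\,dy,\qquad c_\alpha=\alpha\frac{2^{\alpha-1}\Gamma(1/2+\alpha/2)}{\sqrt\pi\,\Gamma(1-\alpha/2)},\quad c_1=\frac1\pi ,$$ where the principal value is the limit as $\varepsilon\to0^+$ of the (absolutely convergent) integrals over $|y|>\varepsilon$. With the change of variable $x=L\cot(s)$, for an integer $k$, $(-\Delta)_s^{1/2}e^{iks}$ denotes the value at $x=L\cot(s)$ of $(-\Delta)^{1/2}$ applied to the function $x\mapsto e^{ik\operatorname{arccot}(x/L)}$, where $\operatorname{arccot}$ takes values in $(0,\pi)$. Let $P$ be any natural number with $P\ge 2M+1$, and let $\tilde b,\tilde c$ be the $P$-periodic sequences (indexed by $\mathbb Z$) given on $0\le l\le P-1$ by $$\tilde b_l=\begin{cases}(8l+4)a_l,&0\le l\le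 M,\\0,&M+1\le l\le P-1,\end{cases}$$ $$\tilde c_l=\begin{cases}\frac13,&l=0,\\0,&1\le l\le P-M-1,\\ \dfrac1{(2(l-P)-3)(2(l-P)-1)(2(l-P)+1)},&P-M\le l\le P-1,\end{cases}$$ with discrete convolution $(\tilde b\ast\tilde c)_l=\sum_{n=0}^{P-1}\tilde b_n\tilde c_{l-n}$. Then $(-\Delta)_s^{1/2}e^{-i(2l+1)s}$ exists (the principal value converges) for every $0\le l\le M$, and $$\sum_{l=0}^M a_l(-\Delta)_s^{1/2}e^{-i(2l+1)s}=\frac{2i}{L\pi}\sum_{l=0}^M\frac{a_l}{2l+3}-\frac{2i}{L\pi}\sum_{l=0}^M(\tilde b\ast\tilde c)_l\,e^{-2ils}$$ $$\qquad+\frac{2i}{L\pi}\Big(\cos(s)+\sin^2(s)\ln\big(\cot\tfrac s2\big)\Big)\sum_{l=0}^M(2l+1)a_l\,e^{-i(2l+1)s}.$$ -/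

import Mathlib

open Filter Topology MeasureTheory Set

noncomputable section

namespace HalfLaplacian

/-- The principal value integral of `f` over `ℝ`, with respect to the singularity `0`, converges
to `I`: `f` is integrable away from `0`, and the integrals over `|y| > ε` tend to `I`
as `ε` decreases to `0`. -/
def HasPVIntegral (f : ℝ → ℂ) (I : ℂ) : Prop :=
  (∀ ε : ℝ, 0 < ε → IntegrableOn f {y : ℝ | ε < |y|}) ∧
    Tendsto (fun ε : ℝ => ∫ y in {y : ℝ | ε < |y|}, f y) (𝓝[>] 0) (𝓝 I)

/-- The value of the principal value integral (meaningful when it converges). -/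
def pvIntegral (f : ℝ → ℂ) : ℂ :=
  limUnder (𝓝[>] (0 : ℝ)) (fun ε : ℝ => ∫ y in {y : ℝ | ε < |y|}, f y)

theorem HasPVIntegral.pvIntegral_eq {f : ℝ → ℂ} {I : ℂ} (h : HasPVIntegral f I) :
    pvIntegral f = I :=
  h.2.limUnder_eq

/-- The normalizing constant `c_α` of the fractional Laplacian of order `α`. -/
def fracLaplacianConst (α : ℝ) : ℝ :=
  α * (2 ^ (α - 1) * Real.Gamma (1 / 2 + α / 2)) / (√Real.pi * Real.Gamma (1 - α / 2))

/-- The integrand `y ↦ (u(x) - u(x + y)) / |y|^(1 + α)`. -/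
def fracLaplacianIntegrand (α : ℝ) (u : ℝ → ℂ) (x y : ℝ) : ℂ :=
  (u x - u (x + y)) / ((|y| ^ (1 + α) : ℝ) : ℂ)

/-- The fractional Laplacian of `u`, of order `α ∈ (0, 2)`, exists at the point `x`. -/
def FracLaplacianExistsAt (α : ℝ) (u : ℝ → ℂ) (x : ℝ) : Prop :=
  ∃ I : ℂ, HasPVIntegral (fracLaplacianIntegrand α u x) I

/-- The fractional Laplacian `(-Δ)^(α/2) u (x)` on `ℝ`, for `α ∈ (0, 2)`. -/
def fracLaplacian (α : ℝ) (u : ℝ → ℂ) (x : ℝ) : ℂ :=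
  (fracLaplacianConst α : ℂ) * pvIntegral (fracLaplacianIntegrand α u x)

/-- The inverse cotangent with values in `(0, π)`. -/
def arccot (x : ℝ) : ℝ := Real.pi / 2 - Real.arctan x

theorem arccot_mem_Ioo (x : ℝ) : arccot x ∈ Ioo 0 Real.pi := by
  unfold arccot
  constructor
  · linarith [Real.arctan_lt_pi_div_two x]
  · linarith [Real.neg_pi_div_two_lt_arctan x]

theorem cot_arccot (x : ℝ) : Real.cot (arccot x) = x := by
  rw [Real.cot_eq_cos_div_sin, arccot, Real.cos_pi_div_two_sub, Real.sin_pi_div_two_sub,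
    ← Real.tan_eq_sin_div_cos, Real.tan_arctan]

/-- The function of `x ∈ ℝ` obtained from a function `U` of `s ∈ (0, π)` by the change of
variable `x = L cot s`, that is `s = arccot (x / L)`. -/
def pullback (L : ℝ) (U : ℝ → ℂ) (x : ℝ) : ℂ := U (arccot (x / L))

/-- The half Laplacian `(-Δ)_s^(1/2) U (s)`: that of the function of `x` which corresponds to `U`,
at the point `x = L cot s`. -/
def halfLaplacianS (L : ℝ) (U : ℝ → ℂ) (s : ℝ) : ℂ :=
  fracLaplacian 1 (pullback L U) (L * Real.cot s)

/-- The half Laplacian `(-Δ)_s^(1/2) U (s)` exists. -/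
def HalfLaplacianSExistsAt (L : ℝ) (U : ℝ → ℂ) (s : ℝ) : Prop :=
  FracLaplacianExistsAt 1 (pullback L U) (L * Real.cot s)

/-- The function `s ↦ e^{iks}`. -/
def expFun (k : ℤ) (s : ℝ) : ℂ := Complex.exp (Complex.I * k * s)

/-- The discrete convolution of two `P`-periodic sequences. -/
def cyclicConv (P : ℕ) (b c : ℤ → ℂ) (l : ℤ) : ℂ :=
  ∑ n ∈ Finset.range P, b n * c (l - n)

/-- The `P`-periodic sequence that is `(8 l + 4) a_l` for `0 ≤ l ≤ M` and `0` for
`M + 1 ≤ l ≤ P - 1`; here `l % P` is the representative of `l` in `{0, …, P - 1}`. -/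
def bTilde (M P : ℕ) (a : ℕ → ℂ) (l : ℤ) : ℂ :=
  if l % P ≤ M then (8 * ((l % P : ℤ) : ℂ) + 4) * a (l % P).toNat else 0

/-- The values for `0 ≤ l ≤ P - 1` of the sequence `cTilde`. -/
def cTildeBase (M P : ℕ) (l : ℤ) : ℂ :=
  if l = 0 then 1 / 3
  else if l ≤ (P : ℤ) - M - 1 then 0
  else 1 / ((2 * ((l : ℂ) - P) - 3) * (2 * ((l : ℂ) - P) - 1) * (2 * ((l : ℂ) - P) + 1))

/-- The `P`-periodic extension of `cTildeBase`. -/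
def cTilde (M P : ℕ) (l : ℤ) : ℂ := cTildeBase M P (l % P)

end HalfLaplacian

end

/-!
The substitution `x + y = L cot (s + w)` turns `dy / y²` into `-(sin² s / L) dw / sin² w`, so that
the half Laplacian of `U` at `s` is, up to a factor, the principal value of
`∫ (U s - U (s + w)) / sin² w dw` over a period `π`. For `U s = e^{-i(2n+1)s}` integration by parts
against `-cot w` leaves `∫ e^{-i(2n+1)w} cot w dw`, which is elementary: it is a truncation of the
series of `2 artanh (e^{-iw})`, plus `log tan (w/2)`. The logarithmic singularity at `w = 0` is
even, so it cancels in the principal value, and the logarithm contributes only `log cot (s/2)`.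

The factor `sin² s` acts on the coefficients `1/(2m+1)` of the artanh polynomial as a second
difference, which produces the coefficients `1/((2k-3)(2k-1)(2k+1))` of `cTilde`. The resulting
triangular double sum is a cyclic convolution because a period `P ≥ 2M+1` rules out aliasing.
-/

namespace HalfLaplacian

section PrincipalValue

theorem setOf_lt_abs (ε : ℝ) : {y : ℝ | ε < |y|} = Iio (-ε) ∪ Ioi ε := by
  ext y
  simp only [mem_ofPred_eq, mem_union, mem_Iio, mem_Ioi, lt_abs, lt_neg, or_comm]

theorem hasPVIntegral_of_hasDerivAt {f F : ℝ → ℂ} {a b : ℂ}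
    (hf : ∀ ε : ℝ, 0 < ε → IntegrableOn f {y : ℝ | ε < |y|})
    (hF : ∀ y : ℝ, y ≠ 0 → HasDerivAt F (f y) y)
    (htop : Tendsto F atTop (𝓝 a)) (hbot : Tendsto F atBot (𝓝 b))
    (hzero : Tendsto (fun ε : ℝ => F ε - F (-ε)) (𝓝[>] 0) (𝓝 0)) :
    HasPVIntegral f (a - b) := by
  have integral_eq : ∀ ε : ℝ, 0 < ε →
      ∫ y in {y : ℝ | ε < |y|}, f y = a - b - (F ε - F (-ε)) := by
    intro ε hε
    have hint := hf ε hε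
    rw [setOf_lt_abs] at hint ⊢
    have hleft : ∫ y in Iio (-ε), f y = F (-ε) - b := by
      rw [← integral_Iic_eq_integral_Iio]
      exact integral_Iic_of_hasDerivAt_of_tendsto'
        (fun y hy => hF y (hy.trans_lt (neg_lt_zero.2 hε)).ne)
        ((integrableOn_Iic_iff_integrableOn_Iio).2 hint.left_of_union) hbot
    have hright : ∫ y in Ioi ε, f y = a - F ε :=
      integral_Ioi_of_hasDerivAt_of_tendsto' (fun y hy => hF y (hε.trans_le hy).ne')
        hint.right_of_union htop
    have hdisj : Disjoint (Iio (-ε)) (Ioi ε) :=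
      (Iio_disjoint_Ioi_iff).2 (by linarith)
    rw [setIntegral_union hdisj measurableSet_Ioi hint.left_of_union hint.right_of_union,
      hleft, hright]
    ring
  refine ⟨hf, Tendsto.congr' ?_ (by simpa only [sub_zero] using hzero.const_sub (a - b))⟩
  filter_upwards [self_mem_nhdsWithin] with ε hε
  exact (integral_eq ε hε).symm

theorem integrableOn_abs_rpow {p ε : ℝ} (hp : p < -1) (hε : 0 < ε) :
    IntegrableOn (fun y : ℝ => |y| ^ p) {y : ℝ | ε < |y|} := by
  have hright : IntegrableOn (fun y : ℝ => |y| ^ p) (Ioi ε) :=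
    (integrableOn_Ioi_rpow_of_lt hp hε).congr_fun
      (fun y hy => by rw [abs_of_pos (hε.trans hy)]) measurableSet_Ioi
  have hleft : IntegrableOn (fun y : ℝ => |y| ^ p) (Iio (-ε)) := by
    rw [← neg_neg ε] at hright
    simpa only [abs_neg, neg_neg] using hright.comp_neg_Iio
  rw [setOf_lt_abs]
  exact hleft.union hright

theorem integrableOn_fracLaplacianIntegrand {α : ℝ} (hα : 0 < α) {u : ℝ → ℂ} (hu : Measurable u)
    {C : ℝ} (hC : ∀ x, ‖u x‖ ≤ C) (x : ℝ) {ε : ℝ} (hε : 0 < ε) :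
    IntegrableOn (fracLaplacianIntegrand α u x) {y : ℝ | ε < |y|} := by
  have hmeas : Measurable (fracLaplacianIntegrand α u x) := by
    unfold fracLaplacianIntegrand
    fun_prop
  refine ((integrableOn_abs_rpow (p := -(1 + α)) (by linarith) hε).const_mul (2 * C)).mono'
    hmeas.aestronglyMeasurable (Eventually.of_forall fun y => ?_)
  have hnum : ‖u x - u (x + y)‖ ≤ 2 * C :=
    (norm_sub_le _ _).trans (by linarith [hC x, hC (x + y)])
  have hpow : 0 ≤ |y| ^ (1 + α) := by positivity
  rw [fracLaplacianIntegrand, norm_div, Complex.norm_real, Real.norm_of_nonneg hpow,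
    Real.rpow_neg (abs_nonneg y), ← div_eq_mul_inv]
  gcongr

end PrincipalValue

section LogSingularity

/-- `F` has a logarithmic singularity at `0` with coefficient `c`: up to `o(1)`, `F w` is
`c * log |w|` plus a constant, the same one on both sides of `0`. Recall that `Real.log w` is
`log |w|`. -/
def HasLogSingularity (F : ℝ → ℂ) (c : ℂ) : Prop :=
  ∃ r : ℂ, Tendsto (fun w : ℝ => F w - c * Real.log w) (𝓝[≠] 0) (𝓝 r)

theorem hasLogSingularity_log : HasLogSingularity (fun w => Real.log w) 1 :=
  ⟨0, by simp only [one_mul, sub_self, tendsto_const_nhds]⟩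

variable {F : ℝ → ℂ} {c : ℂ}

theorem HasLogSingularity.const_mul (hF : HasLogSingularity F c) (k : ℂ) :
    HasLogSingularity (fun w => k * F w) (k * c) := by
  obtain ⟨r, hr⟩ := hF
  exact ⟨k * r, (hr.const_mul k).congr fun w => by ring⟩

theorem HasLogSingularity.add_tendsto (hF : HasLogSingularity F c) {G : ℝ → ℂ} {b : ℂ}
    (hG : Tendsto G (𝓝[≠] 0) (𝓝 b)) : HasLogSingularity (fun w => F w + G w) c := by
  obtain ⟨r, hr⟩ := hF
  exact ⟨r + b, (hr.add hG).congr fun w => by ring⟩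

theorem HasLogSingularity.comp_hasDerivAt (hF : HasLogSingularity F c) {g : ℝ → ℝ} {d : ℝ}
    (hg : HasDerivAt g d 0) (hg0 : g 0 = 0) (hd : d ≠ 0) :
    HasLogSingularity (fun w => F (g w)) c := by
  obtain ⟨r, hr⟩ := hF
  have hslope : Tendsto (fun w => w⁻¹ * g w) (𝓝[≠] 0) (𝓝 d) := by
    simpa only [zero_add, hg0, sub_zero, smul_eq_mul] using hg.tendsto_slope_zero
  have hlog : Tendsto (fun w => ((Real.log (w⁻¹ * g w) : ℝ) : ℂ)) (𝓝[≠] 0)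
      (𝓝 (Real.log d : ℝ)) :=
    (Complex.continuous_ofReal.tendsto _).comp ((Real.continuousAt_log hd).tendsto.comp hslope)
  have hg_ne : Tendsto g (𝓝[≠] 0) (𝓝[≠] 0) := by
    simpa only [hg0] using hg.tendsto_nhdsNE hd
  refine ⟨r + c * Real.log d, ((hr.comp hg_ne).add (hlog.const_mul c)).congr' ?_⟩
  filter_upwards [hslope.eventually_ne hd] with w hw
  rw [Real.log_mul (left_ne_zero_of_mul hw) (right_ne_zero_of_mul hw), Real.log_inv]
  simp only [Function.comp]
  push_cast
  ring

theorem HasLogSingularity.tendsto_sub_neg (hF : HasLogSingularity F c) :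
    Tendsto (fun ε => F ε - F (-ε)) (𝓝[≠] 0) (𝓝 0) := by
  obtain ⟨r, hr⟩ := hF
  have hneg : Tendsto (fun ε : ℝ => -ε) (𝓝[≠] 0) (𝓝[≠] 0) := by
    simpa only [neg_zero] using (hasDerivAt_neg (0 : ℝ)).tendsto_nhdsNE (neg_ne_zero.2 one_ne_zero)
  rw [← sub_self r]
  refine (hr.sub (hr.comp hneg)).congr fun ε => ?_
  simp only [Function.comp, Real.log_neg_eq_log]
  ring

end LogSingularity

section ChangeOfVariable

theorem arccot_cot {s : ℝ} (hs : s ∈ Ioo 0 Real.pi) : arccot (Real.cot s) = s := by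
  rw [arccot, ← Real.tan_inv_eq_cot, ← Real.tan_pi_div_two_sub,
    Real.arctan_tan (by linarith [hs.2]) (by linarith [hs.1]), sub_sub_cancel]

theorem hasDerivAt_arccot (x : ℝ) : HasDerivAt arccot (-Real.sin (arccot x) ^ 2) x := by
  refine ((Real.hasDerivAt_arctan x).const_sub (Real.pi / 2)).congr_deriv ?_
  rw [arccot, Real.sin_pi_div_two_sub, Real.cos_sq_arctan]

theorem continuous_arccot : Continuous arccot :=
  continuous_const.sub Real.continuous_arctan

theorem tendsto_arccot_atTop : Tendsto arccot atTop (𝓝 0) := by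
  rw [← sub_self (Real.pi / 2)]
  exact (Real.tendsto_arctan_atTop.mono_right nhdsWithin_le_nhds).const_sub _

theorem tendsto_arccot_atBot : Tendsto arccot atBot (𝓝 Real.pi) := by
  rw [show Real.pi = Real.pi / 2 - -(Real.pi / 2) by ring]
  exact (Real.tendsto_arctan_atBot.mono_right nhdsWithin_le_nhds).const_sub _

/-- The angle `w` through which `s` moves when `x = L cot s` moves by `y`, that is
`L cot (s + w) = L cot s + y` with `s + w ∈ (0, π)`. -/
noncomputable def angleShift (L s y : ℝ) : ℝ := arccot ((L * Real.cot s + y) / L) - s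

variable {L s : ℝ}

theorem add_angleShift (L s y : ℝ) :
    s + angleShift L s y = arccot ((L * Real.cot s + y) / L) :=
  add_sub_cancel _ _

theorem angleShift_zero (hL : L ≠ 0) (hs : s ∈ Ioo 0 Real.pi) : angleShift L s 0 = 0 := by
  rw [angleShift, add_zero, mul_div_cancel_left₀ _ hL, arccot_cot hs, sub_self]

theorem sin_add_angleShift_pos (L s y : ℝ) : 0 < Real.sin (s + angleShift L s y) := by
  rw [add_angleShift]
  exact Real.sin_pos_of_mem_Ioo (arccot_mem_Ioo _)

theorem sin_angleShift (hL : L ≠ 0) (hs : s ∈ Ioo 0 Real.pi) (y : ℝ) :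
    L * Real.sin (angleShift L s y) = -y * Real.sin s * Real.sin (s + angleShift L s y) := by
  have hsin := (Real.sin_pos_of_mem_Ioo hs).ne'
  have hsin_t := (sin_add_angleShift_pos L s y).ne'
  have hcot := cot_arccot ((L * Real.cot s + y) / L)
  rw [add_angleShift] at hsin_t ⊢
  rw [angleShift]
  set t := arccot ((L * Real.cot s + y) / L)
  rw [Real.cot_eq_cos_div_sin, Real.cot_eq_cos_div_sin] at hcot
  field_simp at hcot
  rw [Real.sin_sub]
  linear_combination -hcot

theorem sin_angleShift_ne_zero (hL : L ≠ 0) (hs : s ∈ Ioo 0 Real.pi) {y : ℝ} (hy : y ≠ 0) :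
    Real.sin (angleShift L s y) ≠ 0 := by
  refine right_ne_zero_of_mul (a := L) ?_
  rw [sin_angleShift hL hs]
  exact mul_ne_zero (mul_ne_zero (neg_ne_zero.2 hy) (Real.sin_pos_of_mem_Ioo hs).ne')
    (sin_add_angleShift_pos L s y).ne'

theorem hasDerivAt_angleShift (L s y : ℝ) :
    HasDerivAt (angleShift L s) (-Real.sin (s + angleShift L s y) ^ 2 / L) y := by
  have hline : HasDerivAt (fun y : ℝ => (L * Real.cot s + y) / L) (1 / L) y :=
    ((hasDerivAt_id y).const_add _).div_const L
  refine (((hasDerivAt_arccot _).comp y hline).sub_const s).congr_deriv ?_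
  rw [add_angleShift, mul_one_div]

theorem tendsto_angleShift_atTop (hL : 0 < L) (s : ℝ) :
    Tendsto (angleShift L s) atTop (𝓝 (-s)) := by
  rw [← zero_sub]
  exact (tendsto_arccot_atTop.comp
    ((tendsto_atTop_add_const_left _ _ tendsto_id).atTop_div_const hL)).sub_const s

theorem tendsto_angleShift_atBot (hL : 0 < L) (s : ℝ) :
    Tendsto (angleShift L s) atBot (𝓝 (Real.pi - s)) :=
  (tendsto_arccot_atBot.comp
    ((tendsto_atBot_add_const_left _ _ tendsto_id).atBot_div_const hL)).sub_const s

theorem fracLaplacianIntegrand_one (u : ℝ → ℂ) (x y : ℝ) :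
    fracLaplacianIntegrand 1 u x y = (u x - u (x + y)) / (y : ℂ) ^ 2 := by
  rw [fracLaplacianIntegrand, one_add_one_eq_two, Real.rpow_two, sq_abs, Complex.ofReal_pow]

theorem pullback_add (L s : ℝ) (U : ℝ → ℂ) (y : ℝ) :
    pullback L U (L * Real.cot s + y) = U (s + angleShift L s y) := by
  rw [pullback, add_angleShift]

theorem pullback_mul_cot (hL : L ≠ 0) (hs : s ∈ Ioo 0 Real.pi) (U : ℝ → ℂ) :
    pullback L U (L * Real.cot s) = U s := by
  rw [pullback, mul_div_cancel_left₀ _ hL, arccot_cot hs]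

theorem hasDerivAt_comp_angleShift (hL : L ≠ 0) (hs : s ∈ Ioo 0 Real.pi) {U F : ℝ → ℂ}
    (hF : ∀ w, Real.sin w ≠ 0 → HasDerivAt F ((U s - U (s + w)) / (Real.sin w : ℂ) ^ 2) w)
    {y : ℝ} (hy : y ≠ 0) :
    HasDerivAt (fun y => -((Real.sin s : ℂ) ^ 2 / L) * F (angleShift L s y))
      (fracLaplacianIntegrand 1 (pullback L U) (L * Real.cot s) y) y := by
  have hw := sin_angleShift_ne_zero hL hs hy
  refine (((hF _ hw).scomp y (hasDerivAt_angleShift L s y)).const_mul _).congr_deriv ?_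
  rw [fracLaplacianIntegrand_one, pullback_add, pullback_mul_cot hL hs, Complex.real_smul]
  have hsin : (L : ℂ) * (Real.sin (angleShift L s y) : ℂ)
      = -y * (Real.sin s : ℂ) * (Real.sin (s + angleShift L s y) : ℂ) := by
    exact_mod_cast sin_angleShift hL hs y
  have hw' : (Real.sin (angleShift L s y) : ℂ) ≠ 0 := Complex.ofReal_ne_zero.2 hw
  have hL' : (L : ℂ) ≠ 0 := Complex.ofReal_ne_zero.2 hL
  have hy' : (y : ℂ) ≠ 0 := Complex.ofReal_ne_zero.2 hy
  push_cast [-Complex.ofReal_sin]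
  generalize (Real.sin (angleShift L s y) : ℂ) = S at *
  generalize (Real.sin (s + angleShift L s y) : ℂ) = T at *
  generalize U s - U (s + angleShift L s y) = Q
  field_simp
  linear_combination -Q * (L * S - y * (Real.sin s : ℂ) * T) * hsin

theorem hasPVIntegral_pullback (hL : 0 < L) (hs : s ∈ Ioo 0 Real.pi) {U F : ℝ → ℂ}
    (hU : Measurable U) {C : ℝ} (hC : ∀ t, ‖U t‖ ≤ C)
    (hF : ∀ w, Real.sin w ≠ 0 → HasDerivAt F ((U s - U (s + w)) / (Real.sin w : ℂ) ^ 2) w)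
    {c : ℂ} (hF₀ : HasLogSingularity F c) :
    HasPVIntegral (fracLaplacianIntegrand 1 (pullback L U) (L * Real.cot s))
      ((Real.sin s : ℂ) ^ 2 / L * (F (Real.pi - s) - F (-s))) := by
  have hsin := (Real.sin_pos_of_mem_Ioo hs).ne'
  have hmeas : Measurable (pullback L U) :=
    hU.comp (continuous_arccot.comp (continuous_id.div_const L)).measurable
  have htop := ((hF (-s) (by rwa [Real.sin_neg, neg_ne_zero])).continuousAt.tendsto.comp
    (tendsto_angleShift_atTop hL s)).const_mul (-((Real.sin s : ℂ) ^ 2 / L))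
  have hbot := ((hF (Real.pi - s) (by rwa [Real.sin_pi_sub])).continuousAt.tendsto.comp
    (tendsto_angleShift_atBot hL s)).const_mul (-((Real.sin s : ℂ) ^ 2 / L))
  have hslope : -Real.sin (s + angleShift L s 0) ^ 2 / L ≠ 0 :=
    div_ne_zero (neg_ne_zero.2 (pow_pos (sin_add_angleShift_pos L s 0) 2).ne') hL.ne'
  have hzero := ((hF₀.comp_hasDerivAt (hasDerivAt_angleShift L s 0) (angleShift_zero hL.ne' hs)
    hslope).const_mul (-((Real.sin s : ℂ) ^ 2 / L))).tendsto_sub_neg.mono_left (nhdsGT_le_nhdsNE 0)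
  convert hasPVIntegral_of_hasDerivAt
    (fun ε hε => integrableOn_fracLaplacianIntegrand one_pos hmeas (fun x => hC _) _ hε)
    (fun y hy => hasDerivAt_comp_angleShift hL.ne' hs hF hy) htop hbot hzero using 1
  ring

theorem fracLaplacianConst_one : fracLaplacianConst 1 = 1 / Real.pi := by
  have hhalf : (1 : ℝ) - 1 / 2 = 1 / 2 := by norm_num
  rw [fracLaplacianConst, add_halves, hhalf, Real.Gamma_one, Real.Gamma_one_half_eq,
    Real.mul_self_sqrt Real.pi_pos.le, sub_self, Real.rpow_zero, one_mul, one_mul]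

end ChangeOfVariable

section Exponentials

theorem expFun_apply_add (k : ℤ) (s t : ℝ) : expFun k (s + t) = expFun k s * expFun k t := by
  rw [expFun, expFun, expFun, ← Complex.exp_add, Complex.ofReal_add, mul_add]

theorem expFun_apply_neg (k : ℤ) (s : ℝ) : expFun k (-s) = (expFun k s)⁻¹ := by
  rw [expFun, expFun, ← Complex.exp_neg, Complex.ofReal_neg, mul_neg]

theorem expFun_apply_zero (k : ℤ) : expFun k 0 = 1 := by
  rw [expFun, Complex.ofReal_zero, mul_zero, Complex.exp_zero]

theorem expFun_ne_zero (k : ℤ) (s : ℝ) : expFun k s ≠ 0 :=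
  Complex.exp_ne_zero _

theorem norm_expFun (k : ℤ) (s : ℝ) : ‖expFun k s‖ = 1 := by
  rw [expFun, ← Complex.norm_exp_ofReal_mul_I (k * s)]
  push_cast
  ring_nf

theorem expFun_natCast_mul (n : ℕ) (k : ℤ) (s : ℝ) : expFun (n * k) s = expFun k s ^ n := by
  rw [expFun, expFun, ← Complex.exp_nat_mul]
  push_cast
  ring_nf

theorem expFun_neg_one (s : ℝ) :
    expFun (-1) s = (Real.cos s : ℂ) - Complex.I * (Real.sin s : ℂ) := by
  rw [expFun, show Complex.I * ((-1 : ℤ) : ℂ) * s = (-s : ℂ) * Complex.I by push_cast; ring,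
    Complex.exp_mul_I, Complex.cos_neg, Complex.sin_neg]
  push_cast
  ring

theorem hasDerivAt_expFun (k : ℤ) (s : ℝ) :
    HasDerivAt (expFun k) (Complex.I * k * expFun k s) s := by
  have hlin : HasDerivAt (fun s : ℝ => Complex.I * k * (s : ℂ)) (Complex.I * k * 1) s :=
    (Complex.ofRealCLM.hasDerivAt (x := s)).const_mul (Complex.I * k)
  refine hlin.cexp.congr_deriv ?_
  rw [expFun]
  ring

theorem continuous_expFun (k : ℤ) : Continuous (expFun k) := by
  unfold expFun
  fun_prop

end Exponentials

section ArtanhPoly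

/-- The truncation `∑_{m<n} 2 z^{2m+1}/(2m+1) + z^{2n+1}/(2n+1)` of the series of `2 artanh z`.
Halving the last coefficient makes `(1 - z²)` times the derivative a three-term polynomial. -/
def artanhPoly {K : Type*} [Field K] (n : ℕ) (z : K) : K :=
  2 * ∑ m ∈ Finset.range n, z ^ (2 * m + 1) / (2 * (m : K) + 1)
    + z ^ (2 * n + 1) / (2 * (n : K) + 1)

theorem artanhPoly_neg {K : Type*} [Field K] (n : ℕ) (z : K) :
    artanhPoly n (-z) = -artanhPoly n z := by
  have hodd : ∀ m : ℕ, (-z) ^ (2 * m + 1) = -z ^ (2 * m + 1) := fun m => Odd.neg_pow ⟨m, rfl⟩ z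
  simp only [artanhPoly, hodd, neg_div, Finset.sum_neg_distrib]
  ring

theorem two_mul_natCast_add_one_ne_zero {K : Type*} [Semiring K] [CharZero K] (n : ℕ) :
    2 * (n : K) + 1 ≠ 0 := by
  exact_mod_cast Nat.succ_ne_zero (2 * n)

theorem hasDerivAt_artanhPoly {𝕜 : Type*} [NontriviallyNormedField 𝕜] [CharZero 𝕜] (n : ℕ)
    (z : 𝕜) :
    HasDerivAt (artanhPoly n) (2 * ∑ m ∈ Finset.range n, (z ^ 2) ^ m + (z ^ 2) ^ n) z := by
  have hterm : ∀ m : ℕ,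
      HasDerivAt (fun z : 𝕜 => z ^ (2 * m + 1) / (2 * (m : 𝕜) + 1)) ((z ^ 2) ^ m) z := by
    intro m
    have hm := two_mul_natCast_add_one_ne_zero (K := 𝕜) m
    refine ((hasDerivAt_pow (2 * m + 1) z).div_const _).congr_deriv ?_
    push_cast
    rw [mul_div_cancel_left₀ _ hm, pow_mul]
  exact ((HasDerivAt.fun_sum fun m _ => hterm m).const_mul 2).add (hterm n)

theorem one_sub_mul_two_mul_geom_sum_add {R : Type*} [CommRing R] (n : ℕ) (x : R) :
    (1 - x) * (2 * ∑ m ∈ Finset.range n, x ^ m + x ^ n) = 2 - (1 + x) * x ^ n := by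
  linear_combination 2 * mul_neg_geom_sum x n

theorem sub_inv_sq_mul_artanhPoly {K : Type*} [Field K] [CharZero K] (n : ℕ) {z : K}
    (hz : z ≠ 0) :
    (z - z⁻¹) ^ 2 * artanhPoly n z =
      (z ^ 2 - z⁻¹ ^ 2) * z ^ (2 * n + 1) / (2 * n + 1)
        + 4 * z ^ (2 * n + 1) / ((2 * n + 1) * (2 * n + 3)) + 2 * (z + z⁻¹)
        + 16 * ∑ j ∈ Finset.range (n + 1),
          z ^ (2 * j + 1) / ((2 * (j : K) - 1) * (2 * j + 1) * (2 * j + 3)) := by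
  induction n with
  | zero =>
    simp only [artanhPoly, Finset.range_zero, Finset.sum_empty, zero_add, Finset.range_one,
      Finset.sum_singleton]
    push_cast
    field_simp
    ring
  | succ n ih =>
    have h1 := two_mul_natCast_add_one_ne_zero (K := K) n
    have h3 : 2 * (n : K) + 3 ≠ 0 := by exact_mod_cast Nat.succ_ne_zero (2 * n + 2)
    have h5 : 2 * (n : K) + 5 ≠ 0 := by exact_mod_cast Nat.succ_ne_zero (2 * n + 4)
    have hsucc : artanhPoly (n + 1) z =
        artanhPoly n z + z ^ (2 * n + 1) / (2 * n + 1) + z ^ (2 * n + 3) / (2 * n + 3) := by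
      simp only [artanhPoly, Finset.sum_range_succ]
      push_cast
      ring
    rw [Finset.sum_range_succ, hsucc, mul_add, mul_add, ih]
    push_cast
    rw [show 2 * ((n : K) + 1) - 1 = 2 * n + 1 by ring,
      show 2 * ((n : K) + 1) + 1 = 2 * n + 3 by ring,
      show 2 * ((n : K) + 1) + 3 = 2 * n + 5 by ring]
    field_simp
    ring

end ArtanhPoly

section CirclePrimitive

theorem hasDerivAt_cot {w : ℝ} (hw : Real.sin w ≠ 0) :
    HasDerivAt Real.cot (-1 / Real.sin w ^ 2) w := by
  rw [funext Real.cot_eq_cos_div_sin]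
  refine ((Real.hasDerivAt_cos w).div (Real.hasDerivAt_sin w) hw).congr_deriv ?_
  rw [← Real.sin_sq_add_cos_sq w]
  ring

theorem hasDerivAt_tan_half {w : ℝ} (hw : Real.cos (w / 2) ≠ 0) :
    HasDerivAt (fun w : ℝ => Real.tan (w / 2)) (1 / (2 * Real.cos (w / 2) ^ 2)) w := by
  refine ((Real.hasDerivAt_tan hw).comp (h := fun w : ℝ => w / 2) w
    ((hasDerivAt_id w).div_const 2)).congr_deriv ?_
  rw [div_mul_div_comm, one_mul, mul_comm]

theorem hasDerivAt_log_tan_half {w : ℝ} (hw : Real.sin w ≠ 0) :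
    HasDerivAt (fun w : ℝ => Real.log (Real.tan (w / 2))) (1 / Real.sin w) w := by
  have hdouble : Real.sin w = 2 * Real.sin (w / 2) * Real.cos (w / 2) := by
    rw [← Real.sin_two_mul, mul_div_cancel₀ w two_ne_zero]
  rw [hdouble] at hw ⊢
  have hcos : Real.cos (w / 2) ≠ 0 := right_ne_zero_of_mul hw
  have hsin : Real.sin (w / 2) ≠ 0 := right_ne_zero_of_mul (left_ne_zero_of_mul hw)
  have htan : Real.tan (w / 2) ≠ 0 := by
    rw [Real.tan_eq_sin_div_cos]
    exact div_ne_zero hsin hcos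
  refine ((hasDerivAt_tan_half hcos).log htan).congr_deriv ?_
  rw [Real.tan_eq_sin_div_cos]
  field_simp

theorem hasLogSingularity_log_tan_half :
    HasLogSingularity (fun w => Real.log (Real.tan (w / 2))) 1 := by
  have hcos : Real.cos (0 / 2) ≠ 0 := by simp
  exact hasLogSingularity_log.comp_hasDerivAt (hasDerivAt_tan_half hcos)
    (by rw [zero_div, Real.tan_zero]) (by positivity)

theorem tendsto_cot_mul_nhdsNE_zero {f : ℝ → ℂ} {d : ℂ} (hf : HasDerivAt f d 0) (hf₀ : f 0 = 0) :
    Tendsto (fun w : ℝ => (Real.cot w : ℂ) * f w) (𝓝[≠] 0) (𝓝 d) := by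
  have hslope : Tendsto (fun w : ℝ => (w : ℂ)⁻¹ * f w) (𝓝[≠] 0) (𝓝 d) := by
    simpa [hf₀] using hf.tendsto_slope_zero
  have hcot : Tendsto (fun w : ℝ => ((Real.cos w / Real.sinc w : ℝ) : ℂ)) (𝓝[≠] 0) (𝓝 1) := by
    have hcont : ContinuousAt (fun w : ℝ => ((Real.cos w / Real.sinc w : ℝ) : ℂ)) 0 :=
      Complex.continuous_ofReal.continuousAt.comp (Real.continuous_cos.continuousAt.div
        Real.continuous_sinc.continuousAt (by simp))
    simpa using hcont.tendsto.mono_left nhdsWithin_le_nhds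
  rw [← one_mul d]
  refine (hcot.mul hslope).congr' ?_
  filter_upwards [self_mem_nhdsWithin] with w hw
  have hw' : (w : ℂ) ≠ 0 := Complex.ofReal_ne_zero.2 hw
  rw [Real.sinc_of_ne_zero hw, Real.cot_eq_cos_div_sin]
  push_cast
  field_simp

theorem I_mul_sin_mul_deriv_artanhPoly (n : ℕ) (w : ℝ) :
    Complex.I * Real.sin w * (expFun (-1) w * (2 * ∑ m ∈ Finset.range n, (expFun (-1) w ^ 2) ^ m
      + (expFun (-1) w ^ 2) ^ n)) = 1 - Real.cos w * expFun (-1) w ^ (2 * n + 1) := by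
  have hsum := one_sub_mul_two_mul_geom_sum_add n (expFun (-1) w ^ 2)
  have hunit : (Real.cos w : ℂ) ^ 2 + (Real.sin w : ℂ) ^ 2 = 1 := by
    exact_mod_cast Real.cos_sq_add_sin_sq w
  have hsin : 1 - expFun (-1) w ^ 2 = 2 * Complex.I * Real.sin w * expFun (-1) w := by
    rw [expFun_neg_one]
    linear_combination -hunit + (Real.sin w : ℂ) ^ 2 * Complex.I_sq
  have hcos : 1 + expFun (-1) w ^ 2 = 2 * Real.cos w * expFun (-1) w := by
    rw [expFun_neg_one]
    linear_combination -hunit + (Real.sin w : ℂ) ^ 2 * Complex.I_sq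
  rw [hsin, hcos, ← pow_mul] at hsum
  rw [← pow_mul]
  linear_combination hsum / 2

theorem hasDerivAt_artanhPoly_expFun (n : ℕ) {w : ℝ} (hw : Real.sin w ≠ 0) :
    HasDerivAt (fun w => artanhPoly n (expFun (-1) w))
      ((Real.cos w * expFun (-1) w ^ (2 * n + 1) - 1) / Real.sin w) w := by
  have hw' : (Real.sin w : ℂ) ≠ 0 := Complex.ofReal_ne_zero.2 hw
  refine ((hasDerivAt_artanhPoly n _).comp w (hasDerivAt_expFun (-1) w)).congr_deriv ?_
  rw [eq_div_iff hw']
  push_cast [-Complex.ofReal_sin, -Complex.ofReal_cos]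
  linear_combination -I_mul_sin_mul_deriv_artanhPoly n w

/-- A primitive of `(1 - e^{-i(2n+1)w}) / sin² w` away from the zeros of `sin`, obtained by
integrating by parts against `-cot`. -/
noncomputable def circlePrimitive (n : ℕ) (w : ℝ) : ℂ :=
  Complex.I * (2 * n + 1) * (Real.log (Real.tan (w / 2)) : ℝ)
    + (Complex.I * (2 * n + 1) * artanhPoly n (expFun (-1) w)
      - Real.cot w * (1 - expFun (-1) w ^ (2 * n + 1)))

theorem hasDerivAt_one_sub_expFun_pow (n : ℕ) (w : ℝ) :
    HasDerivAt (fun w => 1 - expFun (-1) w ^ n) (Complex.I * n * expFun (-1) w ^ n) w := by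
  simp only [← expFun_natCast_mul]
  refine ((hasDerivAt_expFun _ w).const_sub 1).congr_deriv ?_
  push_cast
  ring

theorem hasDerivAt_circlePrimitive (n : ℕ) {w : ℝ} (hw : Real.sin w ≠ 0) :
    HasDerivAt (circlePrimitive n)
      ((1 - expFun (-1) w ^ (2 * n + 1)) / (Real.sin w : ℂ) ^ 2) w := by
  have hw' : (Real.sin w : ℂ) ≠ 0 := Complex.ofReal_ne_zero.2 hw
  have hlog := (hasDerivAt_log_tan_half hw).ofReal_comp.const_mul (Complex.I * (2 * (n : ℂ) + 1))
  have hpoly := (hasDerivAt_artanhPoly_expFun n hw).const_mul (Complex.I * (2 * (n : ℂ) + 1))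
  have hcot := (hasDerivAt_cot hw).ofReal_comp.mul (hasDerivAt_one_sub_expFun_pow (2 * n + 1) w)
  refine (hlog.add (hpoly.sub hcot)).congr_deriv ?_
  rw [Real.cot_eq_cos_div_sin]
  push_cast [-Complex.ofReal_sin, -Complex.ofReal_cos]
  field_simp
  ring

theorem hasLogSingularity_circlePrimitive (n : ℕ) :
    HasLogSingularity (circlePrimitive n) (Complex.I * (2 * n + 1)) := by
  have hcont : Continuous fun w => artanhPoly n (expFun (-1) w) := by
    have := continuous_expFun (-1)
    unfold artanhPoly
    fun_prop
  have hpoly : Tendsto (fun w => Complex.I * (2 * n + 1) * artanhPoly n (expFun (-1) w)) (𝓝[≠] 0)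
      (𝓝 (Complex.I * (2 * n + 1) * artanhPoly n (expFun (-1) 0))) :=
    ((hcont.tendsto 0).mono_left nhdsWithin_le_nhds).const_mul _
  have hcot := tendsto_cot_mul_nhdsNE_zero (hasDerivAt_one_sub_expFun_pow (2 * n + 1) 0)
    (by rw [expFun_apply_zero, one_pow, sub_self])
  have hlog := hasLogSingularity_log_tan_half.const_mul (Complex.I * (2 * n + 1))
  rw [mul_one] at hlog
  exact hlog.add_tendsto (hpoly.sub hcot)

theorem expFun_neg_one_pi_sub (s : ℝ) : expFun (-1) (Real.pi - s) = -(expFun (-1) s)⁻¹ := by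
  rw [sub_eq_add_neg, expFun_apply_add, expFun_apply_neg, expFun_neg_one Real.pi, Real.cos_pi,
    Real.sin_pi]
  push_cast
  ring

theorem circlePrimitive_pi_sub_sub_neg (n : ℕ) (s : ℝ) :
    circlePrimitive n (Real.pi - s) - circlePrimitive n (-s) =
      2 * Complex.I * (2 * n + 1)
          * (Real.log (Real.cot (s / 2)) - artanhPoly n (expFun (-1) s)⁻¹)
        + 2 * (Real.cot s : ℂ) * (expFun (-1) s)⁻¹ ^ (2 * n + 1) := by
  have hlog_neg : Real.log (Real.tan (-s / 2)) = -Real.log (Real.cot (s / 2)) := by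
    rw [neg_div, Real.tan_neg, Real.log_neg_eq_log, ← Real.tan_inv_eq_cot, Real.log_inv, neg_neg]
  have htan_pi_sub : Real.tan ((Real.pi - s) / 2) = Real.cot (s / 2) := by
    rw [sub_div, Real.tan_pi_div_two_sub, Real.tan_inv_eq_cot]
  have hcot_neg : Real.cot (-s) = -Real.cot s := by
    rw [← Real.tan_inv_eq_cot, Real.tan_neg, inv_neg, Real.tan_inv_eq_cot]
  have hcot_pi_sub : Real.cot (Real.pi - s) = -Real.cot s := by
    rw [← Real.tan_inv_eq_cot, Real.tan_pi_sub, inv_neg, Real.tan_inv_eq_cot]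
  rw [circlePrimitive, circlePrimitive, expFun_neg_one_pi_sub, expFun_apply_neg, hlog_neg,
    htan_pi_sub, hcot_neg, hcot_pi_sub, artanhPoly_neg, Odd.neg_pow ⟨n, rfl⟩]
  push_cast [-Complex.ofReal_cot]
  ring

end CirclePrimitive

section HalfLaplacianExpFun

variable {L s : ℝ}

theorem expFun_neg_two_mul_add_one (n : ℕ) (s : ℝ) :
    expFun (-(2 * (n : ℤ) + 1)) s = expFun (-1) s ^ (2 * n + 1) := by
  rw [← expFun_natCast_mul]
  push_cast
  ring_nf

theorem hasPVIntegral_expFun (hL : 0 < L) (hs : s ∈ Ioo 0 Real.pi) (n : ℕ) :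
    HasPVIntegral
      (fracLaplacianIntegrand 1 (pullback L (expFun (-(2 * (n : ℤ) + 1)))) (L * Real.cot s))
      ((Real.sin s : ℂ) ^ 2 / L * (expFun (-1) s ^ (2 * n + 1)
        * (circlePrimitive n (Real.pi - s) - circlePrimitive n (-s)))) := by
  rw [mul_sub (expFun (-1) s ^ (2 * n + 1))]
  refine hasPVIntegral_pullback hL hs (continuous_expFun _).measurable
    (fun t => (norm_expFun _ t).le) (fun w hw => ?_)
    ((hasLogSingularity_circlePrimitive n).const_mul (expFun (-1) s ^ (2 * n + 1)))
  refine ((hasDerivAt_circlePrimitive n hw).const_mul _).congr_deriv ?_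
  rw [expFun_apply_add, ← expFun_neg_two_mul_add_one, ← expFun_neg_two_mul_add_one]
  ring

theorem halfLaplacianS_expFun_eq_artanhPoly (hL : 0 < L) (hs : s ∈ Ioo 0 Real.pi) (n : ℕ) :
    halfLaplacianS L (expFun (-(2 * (n : ℤ) + 1))) s =
      2 * Complex.I / (L * Real.pi) *
        ((2 * n + 1) * expFun (-1) s ^ (2 * n + 1) * (Real.sin s : ℂ) ^ 2
            * (Real.log (Real.cot (s / 2)) - artanhPoly n (expFun (-1) s)⁻¹)
          - Complex.I * Real.sin s * Real.cos s) := by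
  have hpow : expFun (-1) s ^ (2 * n + 1) * (expFun (-1) s)⁻¹ ^ (2 * n + 1) = 1 := by
    rw [inv_pow, mul_inv_cancel₀ (pow_ne_zero _ (expFun_ne_zero _ s))]
  have hcot : (Real.sin s : ℂ) ^ 2 * Real.cot s = Real.sin s * Real.cos s := by
    have hsin := (Real.sin_pos_of_mem_Ioo hs).ne'
    rw [Real.cot_eq_cos_div_sin]
    norm_cast
    field_simp
  rw [halfLaplacianS, fracLaplacian, (hasPVIntegral_expFun hL hs n).pvIntegral_eq,
    fracLaplacianConst_one, circlePrimitive_pi_sub_sub_neg]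
  push_cast [-Complex.ofReal_sin, -Complex.ofReal_cos, -Complex.ofReal_cot]
  generalize (expFun (-1) s)⁻¹ ^ (2 * n + 1) = E' at *
  generalize expFun (-1) s ^ (2 * n + 1) = E at *
  linear_combination 2 * E * E' / (L * Real.pi) * hcot
    + 2 * Real.sin s * Real.cos s / (L * Real.pi) * (hpow + Complex.I_sq)

theorem four_mul_sin_sq_mul_artanhPoly (n : ℕ) (s : ℝ) :
    4 * (Real.sin s : ℂ) ^ 2 * artanhPoly n (expFun (-1) s)⁻¹ =
      -(4 * Complex.I * Real.sin s * Real.cos s * (expFun (-1) s)⁻¹ ^ (2 * n + 1) / (2 * n + 1)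
        + 4 * (expFun (-1) s)⁻¹ ^ (2 * n + 1) / ((2 * n + 1) * (2 * n + 3)) + 4 * Real.cos s
        + 16 * ∑ j ∈ Finset.range (n + 1), (expFun (-1) s)⁻¹ ^ (2 * j + 1)
          / ((2 * (j : ℂ) - 1) * (2 * j + 1) * (2 * j + 3))) := by
  have hdiff := sub_inv_sq_mul_artanhPoly n (inv_ne_zero (expFun_ne_zero (-1) s))
  have hinv : (expFun (-1) s)⁻¹ = (Real.cos s : ℂ) + Complex.I * (Real.sin s : ℂ) := by
    rw [← expFun_apply_neg, expFun_neg_one, Real.cos_neg, Real.sin_neg]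
    push_cast
    ring
  have hsub : (expFun (-1) s)⁻¹ - (expFun (-1) s)⁻¹⁻¹ = 2 * Complex.I * Real.sin s := by
    rw [inv_inv, hinv, expFun_neg_one]
    ring
  have hadd : (expFun (-1) s)⁻¹ + (expFun (-1) s)⁻¹⁻¹ = 2 * Real.cos s := by
    rw [inv_inv, hinv, expFun_neg_one]
    ring
  rw [sq_sub_sq, hadd, hsub] at hdiff
  linear_combination
    4 * (Real.sin s : ℂ) ^ 2 * artanhPoly n (expFun (-1) s)⁻¹ * Complex.I_sq - hdiff

/-- The value of the sequence `cTilde` at an index `m` with `-M ≤ m ≤ 0`. -/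
noncomputable def convCoeff (m : ℤ) : ℂ :=
  1 / ((2 * (m : ℂ) - 3) * (2 * m - 1) * (2 * m + 1))

theorem sum_convCoeff_mul_pow {z : ℂ} (hz : z ≠ 0) (n : ℕ) :
    ∑ l ∈ Finset.range (n + 1), convCoeff (l - n) * z ^ (2 * l) =
      -(z ^ (2 * n + 1) * ∑ j ∈ Finset.range (n + 1),
        z⁻¹ ^ (2 * j + 1) / ((2 * (j : ℂ) - 1) * (2 * j + 1) * (2 * j + 3))) := by
  rw [← Finset.sum_range_reflect, Finset.mul_sum, ← Finset.sum_neg_distrib]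
  refine Finset.sum_congr rfl fun j hj => ?_
  obtain ⟨m, rfl⟩ := Nat.exists_eq_add_of_le (Finset.mem_range_succ_iff.1 hj)
  have hcoeff : convCoeff ((m : ℤ) - (j + m : ℕ)) =
      -1 / ((2 * (j : ℂ) - 1) * (2 * j + 1) * (2 * j + 3)) := by
    rw [convCoeff, neg_div, ← div_neg]
    push_cast
    ring_nf
  have hpow : z ^ (2 * (j + m) + 1) * z⁻¹ ^ (2 * j + 1) = z ^ (2 * m) := by
    rw [show 2 * (j + m) + 1 = 2 * m + (2 * j + 1) by ring, pow_add, mul_assoc, ← mul_pow,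
      mul_inv_cancel₀ hz, one_pow, mul_one]
  rw [show j + m + 1 - 1 - j = m by omega, hcoeff, ← mul_div_assoc, hpow]
  ring

theorem halfLaplacianS_expFun (hL : 0 < L) (hs : s ∈ Ioo 0 Real.pi) (n : ℕ) :
    halfLaplacianS L (expFun (-(2 * (n : ℤ) + 1))) s =
      2 * Complex.I / (L * Real.pi) *
        (1 / (2 * n + 3)
          - (8 * n + 4) * ∑ l ∈ Finset.range (n + 1), convCoeff (l - n) * expFun (-1) s ^ (2 * l)
          + ((Real.cos s + Real.sin s ^ 2 * Real.log (Real.cot (s / 2)) : ℝ) : ℂ)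
            * ((2 * n + 1) * expFun (-1) s ^ (2 * n + 1))) := by
  have hz := expFun_ne_zero (-1) s
  have hn := two_mul_natCast_add_one_ne_zero (K := ℂ) n
  have hpoly := four_mul_sin_sq_mul_artanhPoly n s
  have hpow : expFun (-1) s ^ (2 * n + 1) * (expFun (-1) s)⁻¹ ^ (2 * n + 1) = 1 := by
    rw [inv_pow, mul_inv_cancel₀ (pow_ne_zero _ hz)]
  rw [halfLaplacianS_expFun_eq_artanhPoly hL hs, sum_convCoeff_mul_pow hz]
  congr 1
  push_cast [-Complex.ofReal_sin, -Complex.ofReal_cos, -Complex.ofReal_cot]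
  generalize ∑ j ∈ Finset.range (n + 1), (expFun (-1) s)⁻¹ ^ (2 * j + 1)
    / ((2 * (j : ℂ) - 1) * (2 * j + 1) * (2 * j + 3)) = T at *
  generalize (expFun (-1) s)⁻¹ ^ (2 * n + 1) = E' at *
  generalize expFun (-1) s ^ (2 * n + 1) = E at *
  rw [← div_div] at hpoly
  linear_combination -(2 * n + 1) * E / 4 * hpoly
    + (Complex.I * Real.sin s * Real.cos s + 1 / (2 * n + 3)) * (hpow + E * E' * mul_inv_cancel₀ hn)

end HalfLaplacianExpFun

section Convolution

variable {M P : ℕ}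

theorem bTilde_natCast (a : ℕ → ℂ) {n : ℕ} (hn : n < P) :
    bTilde M P a n = if n ≤ M then (8 * (n : ℂ) + 4) * a n else 0 := by
  rw [bTilde, Int.emod_eq_of_lt (by omega) (by omega)]
  simp only [Nat.cast_le, Int.cast_natCast, Int.toNat_natCast]

theorem cTilde_sub (hP : 2 * M + 1 ≤ P) {l n : ℕ} (hl : l ≤ M) (hn : n ≤ M) :
    cTilde M P (l - n) = if l ≤ n then convCoeff (l - n) else 0 := by
  rcases lt_trichotomy l n with h | rfl | h
  · have hmod : ((l : ℤ) - n) % P = l - n + P := by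
      rw [← Int.add_emod_right, Int.emod_eq_of_lt (by omega) (by omega)]
    rw [cTilde, hmod, cTildeBase, if_neg (by omega), if_neg (by omega), if_pos h.le, convCoeff]
    push_cast
    simp only [add_sub_cancel_right]
  · rw [if_pos le_rfl, cTilde, sub_self, Int.zero_emod, cTildeBase, if_pos rfl, convCoeff]
    norm_num
  · rw [if_neg (by omega), cTilde, Int.emod_eq_of_lt (by omega) (by omega), cTildeBase,
      if_neg (by omega), if_pos (by omega)]

theorem cyclicConv_bTilde_cTilde (hP : 2 * M + 1 ≤ P) (a : ℕ → ℂ) {l : ℕ} (hl : l ≤ M) :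
    cyclicConv P (bTilde M P a) (cTilde M P) l =
      ∑ n ∈ Finset.range (M + 1),
        if l ≤ n then a n * ((8 * (n : ℂ) + 4) * convCoeff (l - n)) else 0 := by
  have hMP : Finset.range (M + 1) ⊆ Finset.range P := Finset.range_subset_range.2 (by omega)
  rw [cyclicConv, ← Finset.sum_subset hMP fun n hn hnM => ?_]
  · refine Finset.sum_congr rfl fun n hn => ?_
    have hn' : n ≤ M := Finset.mem_range_succ_iff.1 hn
    rw [bTilde_natCast a (by omega), if_pos hn', cTilde_sub hP hl hn', mul_ite, mul_zero]
    congr 1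
    ring
  · rw [Finset.mem_range] at hn hnM
    rw [bTilde_natCast a hn, if_neg (by omega), zero_mul]

theorem sum_cyclicConv_mul (hP : 2 * M + 1 ≤ P) (a e : ℕ → ℂ) :
    ∑ l ∈ Finset.range (M + 1), cyclicConv P (bTilde M P a) (cTilde M P) l * e l =
      ∑ n ∈ Finset.range (M + 1),
        a n * ((8 * (n : ℂ) + 4) * ∑ l ∈ Finset.range (n + 1), convCoeff (l - n) * e l) := by
  have hconv : ∀ l ∈ Finset.range (M + 1), cyclicConv P (bTilde M P a) (cTilde M P) l * e l =
      ∑ n ∈ Finset.range (M + 1),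
        if l ≤ n then a n * ((8 * (n : ℂ) + 4) * (convCoeff (l - n) * e l)) else 0 := by
    intro l hl
    rw [cyclicConv_bTilde_cTilde hP a (Finset.mem_range_succ_iff.1 hl), Finset.sum_mul]
    refine Finset.sum_congr rfl fun n _ => ?_
    rw [ite_mul, zero_mul, mul_assoc, mul_assoc]
  rw [Finset.sum_congr rfl hconv, Finset.sum_comm]
  refine Finset.sum_congr rfl fun n hn => ?_
  have hfilter : (Finset.range (M + 1)).filter (· ≤ n) = Finset.range (n + 1) := by
    ext l
    simp only [Finset.mem_filter, Finset.mem_range] at hn ⊢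
    omega
  rw [← Finset.sum_filter, hfilter, Finset.mul_sum, Finset.mul_sum]

end Convolution

end HalfLaplacian

open HalfLaplacian in
theorem mainTheorem6 (L : ℝ) (hL : 0 < L) (M P : ℕ) (hP : 2 * M + 1 ≤ P) (a : ℕ → ℂ)
    (s : ℝ) (hs : s ∈ Set.Ioo 0 Real.pi) :
    (∀ l ∈ Finset.range (M + 1),
      HalfLaplacian.HalfLaplacianSExistsAt L (HalfLaplacian.expFun (-(2 * (l : ℤ) + 1))) s) ∧
    ∑ l ∈ Finset.range (M + 1),
        a l * HalfLaplacian.halfLaplacianS L (HalfLaplacian.expFun (-(2 * (l : ℤ) + 1))) s =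
      2 * Complex.I / (L * Real.pi) * ∑ l ∈ Finset.range (M + 1), a l / (2 * (l : ℂ) + 3)
      - 2 * Complex.I / (L * Real.pi) * ∑ l ∈ Finset.range (M + 1),
          HalfLaplacian.cyclicConv P (HalfLaplacian.bTilde M P a) (HalfLaplacian.cTilde M P) l
            * Complex.exp (-(Complex.I * 2 * l * s))
      + 2 * Complex.I / (L * Real.pi)
        * ((Real.cos s + Real.sin s ^ 2 * Real.log (Real.cot (s / 2)) : ℝ) : ℂ)
        * ∑ l ∈ Finset.range (M + 1),
            (2 * (l : ℂ) + 1) * a l * Complex.exp (-(Complex.I * (2 * l + 1) * s)) := by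
  have hexp_even : ∀ l : ℕ,
      Complex.exp (-(Complex.I * 2 * l * s)) = expFun (-1) s ^ (2 * l) := fun l => by
    rw [← expFun_natCast_mul, expFun]
    push_cast
    ring_nf
  have hexp_odd : ∀ l : ℕ,
      Complex.exp (-(Complex.I * (2 * l + 1) * s)) = expFun (-1) s ^ (2 * l + 1) := fun l => by
    rw [← expFun_natCast_mul, expFun]
    push_cast
    ring_nf
  refine ⟨fun l _ => ⟨_, hasPVIntegral_expFun hL hs l⟩, ?_⟩
  simp only [hexp_even, hexp_odd, halfLaplacianS_expFun hL hs]
  rw [sum_cyclicConv_mul hP, Finset.mul_sum, Finset.mul_sum, Finset.mul_sum,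
    ← Finset.sum_sub_distrib, ← Finset.sum_add_distrib]
  exact Finset.sum_congr rfl fun n _ => by ring
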